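/- A \emph{bimodal algebra} is a structure $\langle B,+,\cdot,-,0,1,f,g\rangle$ in which $\langle B,+,\cdot,-,0,1\rangle$ is a Boolean algebra (the one-element Boolean algebra is allowed) and $f,g:B\to B$ are modal operators, i.e. $f(0)=g(0)=0$, $f(x+y)=f(x)+f(y)$ and $g(x+y)=g(x)+g(y)$ for all $x,y\in B$. For an operator $h:B\to B$ let $h^\partial(x):=-h(-x)$. A \emph{discriminator decomposition algebra} (DDA) is a bimodal algebra $\langle B,f,g\rangle$, with $B$ nontrivial, such that $f(x)+g(x)=1$ for all $x\neq 0$. Let $\mathbf{DDA}$ be the class of all of them, and let $\mathbf{Eq}(\mathbf{DDA})$ be the equational class generated by $\mathbf{DDA}$, i.e. the smallest class of algebras of the similarity type $\langle +,\cdot,-,0,1,f,g\rangle$ that contains $\mathbf{DDA}$ and is axiomatized by a set of equations. A \emph{Kt-DDA} is a bimodal algebra $\langle B,f,g\rangle$ for which the operator $u(x):=f^\partial(x)\cdot g^\partial(x)$ satisfies the S5 axioms for a necessity operator, that is, for all $x\in B$, $$u(x)\le x,\qquad u(x)\le u(u(x)),\qquad x\le u(u^\partial(x)).$$ (Equivalently,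 $u^\partial(x)=f(x)+g(x)$ is an S5 possibility operator.) Let $\mathbf{KtDDA}$ be the class of all Kt-DDAs. **Theorem.** $\mathbf{Eq}(\mathbf{DDA})=\mathbf{KtDDA}$. -/

import Mathlib

universe u

namespace ModalDecomp

section Operators

variable {B : Type u} [BooleanAlgebra B]

/-- The dual operator `f^∂ (a) = - f (- a)`. -/
def dualOp (f : B → B) : B → B := fun a => (f aᶜ)ᶜ

/-- A modal operator: normal and additive. -/
structure IsModalOperator (f : B → B) : Prop where
  normal : f ⊥ = ⊥
  additive : ∀ x y : B, f (x ⊔ y) = f x ⊔ f y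

/-- A decomposing pair of modal operators: `f x + g x = 1` for all `x ≠ 0`. -/
structure IsDecomposingPair (f g : B → B) : Prop where
  modal_left : IsModalOperator f
  modal_right : IsModalOperator g
  decomposing : ∀ x : B, x ≠ ⊥ → f x ⊔ g x = ⊤

/-- The operator `u (x) = f^∂ (x) · g^∂ (x)`. -/
def meetDual (f g : B → B) : B → B := fun x => dualOp f x ⊓ dualOp g x

/-- The S5 axioms (T, 4, B) for a possibility operator `v`. -/
structure IsS5Possibility (v : B → B) : Prop where
  axiom_T : ∀ x : B, x ≤ v x
  axiom_4 : ∀ x : B, v (v x) ≤ v x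
  axiom_B : ∀ x : B, v (dualOp v x) ≤ x

/-- The S5 axioms (T, 4, B) for a necessity operator `w`. -/
structure IsS5Necessity (w : B → B) : Prop where
  axiom_T : ∀ x : B, w x ≤ x
  axiom_4 : ∀ x : B, w x ≤ w (w x)
  axiom_B : ∀ x : B, x ≤ w (dualOp w x)

/-- `w` is an S5 necessity operator if and only if its dual is an S5 possibility operator. -/
theorem isS5Necessity_iff_dual (w : B → B) :
    IsS5Necessity w ↔ IsS5Possibility (dualOp w) := by
  constructor
  · intro h
    refine ⟨fun x => ?_, fun x => ?_, fun x => ?_⟩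
    · exact le_compl_comm.mp (h.axiom_T xᶜ)
    · simpa [dualOp] using h.axiom_4 xᶜ
    · have := h.axiom_B xᶜ
      simp only [dualOp, compl_compl] at this ⊢
      exact compl_le_iff_compl_le.mp this
  · intro h
    refine ⟨fun x => ?_, fun x => ?_, fun x => ?_⟩
    · have := h.axiom_T xᶜ
      simpa [dualOp] using this
    · have := h.axiom_4 xᶜ
      simpa [dualOp] using this
    · have := h.axiom_B xᶜ
      simpa [dualOp] using this

end Operators

/-- The operation symbols of bimodal algebras `⟨B, +, ·, -, 0, 1, f, g⟩`. -/
inductive BimodalOp : ℕ → Type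
  | zero : BimodalOp 0
  | one : BimodalOp 0
  | compl : BimodalOp 1
  | opF : BimodalOp 1
  | opG : BimodalOp 1
  | add : BimodalOp 2
  | mul : BimodalOp 2

/-- The algebraic similarity type of bimodal algebras (no relation symbols). -/
def bimodalLang : FirstOrder.Language.{0, 0} := ⟨BimodalOp, fun _ => Empty⟩

/-- All algebras of this similarity type (with no laws assumed) on carriers in `Type u`. -/
abbrev Alg : Type (u + 1) := CategoryTheory.Bundled.{u} bimodalLang.Structure.{0, 0, u}

/-- An equation is a pair of terms in countably many variables. -/
abbrev Equation : Type := bimodalLang.Term ℕ × bimodalLang.Term ℕ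

/-- The algebra `A` satisfies the equation `e` identically. -/
def Satisfies (A : Alg.{u}) (e : Equation) : Prop :=
  ∀ v : ℕ → A, e.1.realize v = e.2.realize v

/-- The class of all algebras satisfying all equations of `E`. -/
def modelsOf (E : Set Equation) : Set Alg.{u} := {A | ∀ e ∈ E, Satisfies A e}

/-- Equational classes: classes axiomatized by a set of equations. -/
def IsEquationalClass (K : Set Alg.{u}) : Prop := ∃ E : Set Equation, K = modelsOf E

/-- `Eq(K)`, the equational class generated by `K`: the intersection of all equational classes
that contain `K`. -/
def eqClass (K : Set Alg.{u}) : Set Alg.{u} :=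
  {A | ∀ C : Set Alg.{u}, IsEquationalClass C → K ⊆ C → A ∈ C}

/-- `Eq(K)` consists of the algebras satisfying every equation that is valid in `K`. -/
theorem eqClass_eq_modelsOf (K : Set Alg.{u}) :
    eqClass K = modelsOf {e | ∀ A ∈ K, Satisfies A e} := by
  ext A
  constructor
  · intro h
    exact h _ ⟨_, rfl⟩ (fun A hA e he => he A hA)
  · rintro h C ⟨E, rfl⟩ hK e he
    exact h e (fun A' hA' => hK hA' e he)

/-- `Eq(K)` is itself an equational class. -/
theorem isEquationalClass_eqClass (K : Set Alg.{u}) : IsEquationalClass (eqClass K) :=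
  ⟨_, eqClass_eq_modelsOf K⟩

/-- The algebra `⟨B, +, ·, -, 0, 1, f, g⟩` given by a Boolean algebra `B` and two operators. -/
@[reducible] def bimodalStructure {B : Type u} [BooleanAlgebra B] (f g : B → B) :
    bimodalLang.Structure B where
  funMap {_} s := match s with
    | .zero => fun _ => ⊥
    | .one => fun _ => ⊤
    | .compl => fun x => (x 0)ᶜ
    | .opF => fun x => f (x 0)
    | .opG => fun x => g (x 0)
    | .add => fun x => x 0 ⊔ x 1
    | .mul => fun x => x 0 ⊓ x 1
  RelMap {_} r := r.elim

/-- The class of discriminator decomposition algebras: nontrivial Boolean algebras with a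
decomposing pair of modal operators. -/
def DDA : Set Alg.{u} :=
  {A | Nontrivial A ∧ ∃ (_ : BooleanAlgebra A) (f g : A → A),
    A.str = bimodalStructure f g ∧ IsDecomposingPair f g}

/-- The class of bimodal algebras, possibly with one element, for which
`u (x) = f^∂ (x) · g^∂ (x)` is an S5 (necessity) operator. -/
def KtDDA : Set Alg.{u} :=
  {A | ∃ (_ : BooleanAlgebra A) (f g : A → A),
    A.str = bimodalStructure f g ∧ IsModalOperator f ∧ IsModalOperator g ∧
      IsS5Necessity (meetDual f g)}

end ModalDecomp

/-!
A decomposing pair makes `v x = f x + g x` the unary discriminator (`0` at `0`, and `1` elsewhere),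
which is an S5 possibility operator; as Kt-DDAs are defined by equations, one inclusion follows.

Conversely, let an equation fail in a Kt-DDA, the symmetric difference of its two values being
`a ≠ 0`. Take a prime ideal `P` omitting `a` and put `I = {x | v x ∈ P}`. Axiom T gives `a ∉ I`,
axiom 4 makes `I` a congruence ideal, and axioms 4 and B with the primality of `P` give
`- v x ∈ I` for all `x ∉ I`. So the quotient by `I` is a DDA, and the equation still fails in it.
-/

namespace ModalDecomp

open FirstOrder FirstOrder.Language
open scoped symmDiff

section ModalOperators

variable {B : Type*} [BooleanAlgebra B] {f g v : B → B}

namespace IsModalOperator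

theorem monotone (hf : IsModalOperator f) : Monotone f := fun x y h => by
  rw [← sup_eq_right.2 h, hf.additive]
  exact le_sup_left

theorem sup (hf : IsModalOperator f) (hg : IsModalOperator g) :
    IsModalOperator fun x => f x ⊔ g x where
  normal := by rw [hf.normal, hg.normal, sup_bot_eq]
  additive x y := by rw [hf.additive, hg.additive, sup_sup_sup_comm]

theorem symmDiff_map_le (hf : IsModalOperator f) (x y : B) : f x ∆ f y ≤ f (x ∆ y) := by
  rw [symmDiff_le_iff, ← hf.additive, ← hf.additive]
  obtain ⟨hxy, hyx⟩ := symmDiff_le_iff.1 (le_refl (x ∆ y))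
  exact ⟨hf.monotone hxy, hf.monotone hyx⟩

/-- The inverse image of an ideal under a modal operator. -/
def comapIdeal (hf : IsModalOperator f) (P : Order.Ideal B) : Order.Ideal B :=
  Order.IsIdeal.toIdeal (I := f ⁻¹' P)
    { IsLowerSet := fun _ _ hyx hx => P.lower (hf.monotone hyx) hx
      Nonempty := ⟨⊥, by simp only [Set.mem_preimage, hf.normal, SetLike.mem_coe, P.bot_mem]⟩
      Directed := fun x hx y hy =>
        ⟨x ⊔ y, by simpa only [Set.mem_preimage, hf.additive, SetLike.mem_coe] using
          Order.Ideal.sup_mem hx hy,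
          le_sup_left, le_sup_right⟩ }

theorem mem_comapIdeal (hf : IsModalOperator f) {P : Order.Ideal B} {x : B} :
    x ∈ hf.comapIdeal P ↔ f x ∈ P :=
  Iff.rfl

end IsModalOperator

theorem isS5Necessity_meetDual_iff :
    IsS5Necessity (meetDual f g) ↔ IsS5Possibility fun x => f x ⊔ g x := by
  have dual_meetDual : dualOp (meetDual f g) = fun x => f x ⊔ g x := by
    funext x
    simp only [dualOp, meetDual, compl_inf, compl_compl]
  rw [isS5Necessity_iff_dual, dual_meetDual]

theorem isS5Possibility_of_map_eq_top (hbot : v ⊥ = ⊥) (htop : ∀ x, x ≠ ⊥ → v x = ⊤) :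
    IsS5Possibility v := by
  refine ⟨fun x => ?_, fun x => ?_, fun x => ?_⟩
  · obtain rfl | hx := eq_or_ne x ⊥
    · exact bot_le
    · exact (htop x hx).ge.trans' le_top
  · obtain rfl | hx := eq_or_ne x ⊥
    · rw [hbot, hbot]
    · exact (htop x hx).ge.trans' le_top
  · obtain hx | hx := eq_or_ne xᶜ ⊥
    · exact (compl_eq_bot.1 hx).ge.trans' le_top
    · rw [dualOp, htop _ hx, compl_top, hbot]
      exact bot_le

theorem IsDecomposingPair.isS5Necessity_meetDual (h : IsDecomposingPair f g) :
    IsS5Necessity (meetDual f g) :=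
  isS5Necessity_meetDual_iff.2 <|
    isS5Possibility_of_map_eq_top (h.modal_left.sup h.modal_right).normal h.decomposing

theorem IsS5Possibility.map_compl_map_le (hv : IsS5Possibility v) (x : B) :
    v (v x)ᶜ ≤ (v x)ᶜ := by
  have idem : v (v x) = v x := (hv.axiom_4 x).antisymm (hv.axiom_T _)
  simpa only [dualOp, compl_compl, idem] using hv.axiom_B (v x)ᶜ

theorem exists_isPrime_notMem {α : Type*} [DistribLattice α] {I : Order.Ideal α} {a : α}
    (ha : a ∉ I) : ∃ P : Order.Ideal α, P.IsPrime ∧ I ≤ P ∧ a ∉ P := by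
  have disjoint : Disjoint (Order.PFilter.principal a : Set α) (I : Set α) :=
    Set.disjoint_left.2 fun _ hax hx => ha (I.lower (Order.PFilter.mem_principal.1 hax) hx)
  obtain ⟨P, hP, hIP, hdisj⟩ := DistribLattice.prime_ideal_of_disjoint_filter_ideal disjoint
  exact ⟨P, hP, hIP, Set.disjoint_left.1 hdisj (Order.PFilter.mem_principal.2 le_rfl)⟩

theorem exists_ideal_notMem_of_isS5Possibility (hmod : IsModalOperator v)
    (hv : IsS5Possibility v) {a : B} (ha : a ≠ ⊥) :
    ∃ I : Order.Ideal B, a ∉ I ∧ (∀ x ∈ I, v x ∈ I) ∧ ∀ x ∉ I, (v x)ᶜ ∈ I := by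
  have ha_bot : a ∉ Order.Ideal.principal (⊥ : B) := fun h =>
    ha (le_bot_iff.1 (Order.Ideal.mem_principal.1 h))
  obtain ⟨P, hP, -, haP⟩ := exists_isPrime_notMem ha_bot
  refine ⟨hmod.comapIdeal P, fun h => haP (P.lower (hv.axiom_T a) h),
    fun x hx => P.lower (hv.axiom_4 x) hx, fun x hx => ?_⟩
  have compl_mem : (v x)ᶜ ∈ P := hP.compl_mem_of_notMem (mt hmod.mem_comapIdeal.2 hx)
  exact P.lower (hv.map_compl_map_le x) compl_mem

end ModalOperators

section Terms

variable {α : Type*}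

instance : Bot (bimodalLang.Term α) := ⟨Constants.term (L := bimodalLang) BimodalOp.zero⟩

instance : Top (bimodalLang.Term α) := ⟨Constants.term (L := bimodalLang) BimodalOp.one⟩

instance : Compl (bimodalLang.Term α) := ⟨Functions.apply₁ (L := bimodalLang) BimodalOp.compl⟩

instance : Max (bimodalLang.Term α) := ⟨Functions.apply₂ (L := bimodalLang) BimodalOp.add⟩

instance : Min (bimodalLang.Term α) := ⟨Functions.apply₂ (L := bimodalLang) BimodalOp.mul⟩

/-- The term `f t`. -/
def termF (t : bimodalLang.Term α) : bimodalLang.Term α :=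
  Functions.apply₁ (L := bimodalLang) BimodalOp.opF t

/-- The term `g t`. -/
def termG (t : bimodalLang.Term α) : bimodalLang.Term α :=
  Functions.apply₁ (L := bimodalLang) BimodalOp.opG t

/-- The term `u t`, where `u (x) = f^∂ (x) · g^∂ (x)`. -/
def termU (t : bimodalLang.Term α) : bimodalLang.Term α :=
  (termF tᶜ)ᶜ ⊓ (termG tᶜ)ᶜ

/-- The valuation sending the first three variables to `a`, `b`, `c`, used to instantiate equations
in at most three variables. -/
def valuation (a b c : α) : ℕ → α
  | 0 => a
  | 1 => b
  | _ => c

/-- The equations of Boolean algebras. -/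
def booleanEquations : Set Equation :=
  let x : bimodalLang.Term ℕ := .var 0
  let y : bimodalLang.Term ℕ := .var 1
  let z : bimodalLang.Term ℕ := .var 2
  {(x ⊔ y, y ⊔ x), (x ⊔ y ⊔ z, x ⊔ (y ⊔ z)), (x ⊓ y, y ⊓ x), (x ⊓ y ⊓ z, x ⊓ (y ⊓ z)),
    (x ⊔ x ⊓ y, x), (x ⊓ (x ⊔ y), x), (x ⊓ (y ⊔ z), x ⊓ y ⊔ x ⊓ z),
    (x ⊔ ⊥, x), (x ⊓ ⊤, x), (x ⊓ xᶜ, ⊥), (x ⊔ xᶜ, ⊤)}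

/-- The equations saying that `f` and `g` are modal operators. -/
def modalEquations : Set Equation :=
  let x : bimodalLang.Term ℕ := .var 0
  let y : bimodalLang.Term ℕ := .var 1
  {(termF ⊥, ⊥), (termF (x ⊔ y), termF x ⊔ termF y),
    (termG ⊥, ⊥), (termG (x ⊔ y), termG x ⊔ termG y)}

/-- The S5 axioms for `u`, each inequality `s ≤ t` being encoded as the equation `s · t = s`. -/
def s5Equations : Set Equation :=
  let x : bimodalLang.Term ℕ := .var 0
  {(termU x ⊓ x, termU x), (termU x ⊓ termU (termU x), termU x),
    (x ⊓ termU (termU xᶜ)ᶜ, x)}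

end Terms

theorem modelsOf_union (E F : Set Equation) :
    modelsOf.{u} (E ∪ F) = modelsOf E ∩ modelsOf F :=
  Set.ext fun _ => forall₂_or_left

/-- The algebra `⟨B, +, ·, -, 0, 1, f, g⟩`. -/
def bimodalAlg {B : Type u} [BooleanAlgebra B] (f g : B → B) : Alg.{u} :=
  ⟨B, bimodalStructure f g⟩

instance {B : Type u} [BooleanAlgebra B] (f g : B → B) : BooleanAlgebra (bimodalAlg f g) :=
  ‹BooleanAlgebra B›

theorem eq_bimodalAlg {A : Alg.{u}} [BooleanAlgebra A] {f g : A → A}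
    (h : A.str = bimodalStructure f g) : A = bimodalAlg f g := by
  rw [bimodalAlg, ← h]

theorem mem_KtDDA_iff {A : Alg.{u}} :
    A ∈ KtDDA ↔ ∃ (B : Type u) (_ : BooleanAlgebra B) (f g : B → B),
      A = bimodalAlg f g ∧ IsModalOperator f ∧ IsModalOperator g ∧
        IsS5Necessity (meetDual f g) := by
  constructor
  · rintro ⟨_, f, g, hA, h⟩
    exact ⟨A, _, f, g, eq_bimodalAlg hA, h⟩
  · rintro ⟨B, instB, f, g, rfl, h⟩
    exact ⟨instB, f, g, rfl, h⟩

section BooleanEquations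

/-- The Boolean algebra with the given operations, provided that these satisfy the usual
identities. -/
abbrev booleanAlgebraOfIdentities {B : Type*} [Max B] [Min B] [Compl B] [Bot B] [Top B]
    (sup_comm : ∀ a b : B, a ⊔ b = b ⊔ a) (sup_assoc : ∀ a b c : B, a ⊔ b ⊔ c = a ⊔ (b ⊔ c))
    (inf_comm : ∀ a b : B, a ⊓ b = b ⊓ a) (inf_assoc : ∀ a b c : B, a ⊓ b ⊓ c = a ⊓ (b ⊓ c))
    (sup_inf_self : ∀ a b : B, a ⊔ a ⊓ b = a) (inf_sup_self : ∀ a b : B, a ⊓ (a ⊔ b) = a)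
    (inf_sup_left : ∀ a b c : B, a ⊓ (b ⊔ c) = a ⊓ b ⊔ a ⊓ c)
    (sup_bot : ∀ a : B, a ⊔ ⊥ = a) (inf_top : ∀ a : B, a ⊓ ⊤ = a)
    (inf_compl : ∀ a : B, a ⊓ aᶜ = ⊥) (sup_compl : ∀ a : B, a ⊔ aᶜ = ⊤) : BooleanAlgebra B :=
  letI : Lattice B := Lattice.mk' sup_comm sup_assoc inf_comm inf_assoc sup_inf_self inf_sup_self
  { DistribLattice.ofInfSupLe fun a b c => (inf_sup_left a b c).le with
    compl := compl
    bot := ⊥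
    top := ⊤
    inf_compl_le_bot := fun a => (inf_compl a).le
    top_le_sup_compl := fun a => (sup_compl a).ge
    le_top := fun a => inf_eq_left.1 (inf_top a)
    bot_le := fun a => sup_eq_left.1 (sup_bot a) }

variable {A : Type u} [bimodalLang.Structure A]

local instance : Bot A := ⟨Structure.funMap (L := bimodalLang) BimodalOp.zero ![]⟩

local instance : Top A := ⟨Structure.funMap (L := bimodalLang) BimodalOp.one ![]⟩

local instance : Compl A := ⟨fun a => Structure.funMap (L := bimodalLang) BimodalOp.compl ![a]⟩

local instance : Max A := ⟨fun a b => Structure.funMap (L := bimodalLang) BimodalOp.add ![a, b]⟩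

local instance : Min A := ⟨fun a b => Structure.funMap (L := bimodalLang) BimodalOp.mul ![a, b]⟩

variable {α : Type*} (w : α → A) (s t : bimodalLang.Term α)

theorem realize_bot : (⊥ : bimodalLang.Term α).realize w = ⊥ :=
  congrArg (Structure.funMap (L := bimodalLang) BimodalOp.zero) (Subsingleton.elim _ _)

theorem realize_top : (⊤ : bimodalLang.Term α).realize w = ⊤ :=
  congrArg (Structure.funMap (L := bimodalLang) BimodalOp.one) (Subsingleton.elim _ _)

theorem realize_compl : tᶜ.realize w = (t.realize w)ᶜ :=
  Term.realize_functions_apply₁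

theorem realize_sup : (s ⊔ t).realize w = s.realize w ⊔ t.realize w :=
  Term.realize_functions_apply₂

theorem realize_inf : (s ⊓ t).realize w = s.realize w ⊓ t.realize w :=
  Term.realize_functions_apply₂

theorem exists_eq_bimodalAlg {A : Alg.{u}} (hA : A ∈ modelsOf booleanEquations) :
    ∃ (B : Type u) (_ : BooleanAlgebra B) (f g : B → B), A = bimodalAlg f g := by
  have identities : ∀ e ∈ booleanEquations, ∀ a b c : A,
      e.1.realize (valuation a b c) = e.2.realize (valuation a b c) :=
    fun e he a b c => hA e he _
  simp only [booleanEquations, Set.mem_insert_iff, Set.mem_singleton_iff, forall_eq_or_imp,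
    forall_eq, realize_bot, realize_top, realize_compl, realize_sup, realize_inf,
    Term.realize_var, valuation] at identities
  obtain ⟨sup_comm, sup_assoc, inf_comm, inf_assoc, sup_inf_self, inf_sup_self, inf_sup_left,
    sup_bot, inf_top, inf_compl, sup_compl⟩ := identities
  let _ : BooleanAlgebra A := booleanAlgebraOfIdentities (fun a b => sup_comm a b a) sup_assoc
    (fun a b => inf_comm a b a) inf_assoc (fun a b => sup_inf_self a b a)
    (fun a b => inf_sup_self a b a) inf_sup_left (fun a => sup_bot a a a)
    (fun a => inf_top a a a) (fun a => inf_compl a a a) (fun a => sup_compl a a a)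
  let f : A → A := fun a => Structure.funMap (L := bimodalLang) BimodalOp.opF ![a]
  let g : A → A := fun a => Structure.funMap (L := bimodalLang) BimodalOp.opG ![a]
  have str_eq : A.str = bimodalStructure f g := by
    refine Structure.ext ?_ (funext₂ fun _ r => r.elim)
    funext n op x
    cases op <;> exact congrArg _ (FinVec.etaExpand_eq x).symm
  exact ⟨A, _, f, g, eq_bimodalAlg str_eq⟩

end BooleanEquations

section BimodalAlgebras

variable {B : Type u} [BooleanAlgebra B] {f g : B → B}

theorem bimodalAlg_mem_modelsOf_booleanEquations :
    bimodalAlg f g ∈ modelsOf booleanEquations := by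
  simp only [modelsOf, booleanEquations, Set.mem_ofPred_eq, Set.mem_insert_iff,
    Set.mem_singleton_iff, forall_eq_or_imp, forall_eq]
  exact ⟨fun _ => sup_comm _ _, fun _ => sup_assoc _ _ _, fun _ => inf_comm _ _,
    fun _ => inf_assoc _ _ _, fun _ => sup_inf_self, fun _ => inf_sup_self,
    fun _ => inf_sup_left _ _ _, fun _ => sup_bot_eq _, fun _ => inf_top_eq _,
    fun _ => inf_compl_eq_bot, fun _ => sup_compl_eq_top⟩

theorem bimodalAlg_mem_modelsOf_modalEquations_iff :
    bimodalAlg f g ∈ modelsOf modalEquations ↔ IsModalOperator f ∧ IsModalOperator g := by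
  simp only [modelsOf, modalEquations, Set.mem_ofPred_eq, Set.mem_insert_iff,
    Set.mem_singleton_iff, forall_eq_or_imp, forall_eq]
  constructor
  · rintro ⟨f_bot, f_sup, g_bot, g_sup⟩
    exact ⟨⟨f_bot ⊥, fun x y => f_sup (valuation x y y)⟩,
      ⟨g_bot ⊥, fun x y => g_sup (valuation x y y)⟩⟩
  · rintro ⟨hf, hg⟩
    exact ⟨fun _ => hf.normal, fun _ => hf.additive _ _, fun _ => hg.normal,
      fun _ => hg.additive _ _⟩

theorem bimodalAlg_mem_modelsOf_s5Equations_iff :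
    bimodalAlg f g ∈ modelsOf s5Equations ↔ IsS5Necessity (meetDual f g) := by
  simp only [modelsOf, s5Equations, Set.mem_ofPred_eq, Set.mem_insert_iff,
    Set.mem_singleton_iff, forall_eq_or_imp, forall_eq]
  constructor
  · rintro ⟨eq_T, eq_4, eq_B⟩
    exact ⟨fun x => inf_eq_left.1 (eq_T fun _ => x), fun x => inf_eq_left.1 (eq_4 fun _ => x),
      fun x => inf_eq_left.1 (eq_B fun _ => x)⟩
  · intro h
    exact ⟨fun _ => inf_eq_left.2 (h.axiom_T _), fun _ => inf_eq_left.2 (h.axiom_4 _),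
      fun _ => inf_eq_left.2 (h.axiom_B _)⟩

theorem mem_modelsOf_bimodalEquations_iff {A : Alg.{u}} :
    A ∈ modelsOf (booleanEquations ∪ modalEquations) ↔
      ∃ (B : Type u) (_ : BooleanAlgebra B) (f g : B → B),
        A = bimodalAlg f g ∧ IsModalOperator f ∧ IsModalOperator g := by
  rw [modelsOf_union]
  constructor
  · rintro ⟨hbool, hmodal⟩
    obtain ⟨B, _, f, g, rfl⟩ := exists_eq_bimodalAlg hbool
    exact ⟨B, _, f, g, rfl, bimodalAlg_mem_modelsOf_modalEquations_iff.1 hmodal⟩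
  · rintro ⟨B, _, f, g, rfl, h⟩
    exact ⟨bimodalAlg_mem_modelsOf_booleanEquations,
      bimodalAlg_mem_modelsOf_modalEquations_iff.2 h⟩

theorem KtDDA_eq_modelsOf :
    KtDDA.{u} = modelsOf (booleanEquations ∪ modalEquations ∪ s5Equations) := by
  ext A
  rw [mem_KtDDA_iff, modelsOf_union]
  constructor
  · rintro ⟨B, _, f, g, rfl, hf, hg, hu⟩
    exact ⟨mem_modelsOf_bimodalEquations_iff.2 ⟨B, _, f, g, rfl, hf, hg⟩,
      bimodalAlg_mem_modelsOf_s5Equations_iff.2 hu⟩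
  · rintro ⟨hbimodal, hs5⟩
    obtain ⟨B, _, f, g, rfl, hf, hg⟩ := mem_modelsOf_bimodalEquations_iff.1 hbimodal
    exact ⟨B, _, f, g, rfl, hf, hg, bimodalAlg_mem_modelsOf_s5Equations_iff.1 hs5⟩

theorem isEquationalClass_KtDDA : IsEquationalClass KtDDA.{u} :=
  ⟨_, KtDDA_eq_modelsOf⟩

theorem DDA_subset_KtDDA : DDA.{u} ⊆ KtDDA := by
  rintro A ⟨-, _, f, g, hA, h⟩
  exact ⟨_, f, g, hA, h.modal_left, h.modal_right, h.isS5Necessity_meetDual⟩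

theorem mem_DDA_of_realize {A : Alg.{u}} [Nontrivial A]
    (hA : A ∈ modelsOf (booleanEquations ∪ modalEquations))
    (h : ∀ w : ℕ → A, w 0 ≠ (⊥ : bimodalLang.Term ℕ).realize w →
      (termF (.var 0) ⊔ termG (.var 0) : bimodalLang.Term ℕ).realize w =
        (⊤ : bimodalLang.Term ℕ).realize w) : A ∈ DDA := by
  obtain ⟨B, instB, f, g, rfl, hf, hg⟩ := mem_modelsOf_bimodalEquations_iff.1 hA
  exact ⟨‹_›, instB, f, g, rfl, hf, hg, fun x hx => h (fun _ => x) hx⟩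

end BimodalAlgebras

section Quotients

theorem exists_quotientMk_comp_eq {ι M : Type*} (s : Setoid M) (w : ι → Quotient s) :
    ∃ w' : ι → M, (fun i => ⟦w' i⟧) = w :=
  ⟨fun i => (w i).out, funext fun i => (w i).out_eq⟩

theorem Satisfies.quotient {M : Type u} (s : Setoid M) [ps : bimodalLang.Prestructure s]
    {e : Equation} (h : Satisfies ⟨M, ps.toStructure⟩ e) :
    Satisfies ⟨Quotient s, quotientStructure⟩ e := by
  intro w
  obtain ⟨w, rfl⟩ := exists_quotientMk_comp_eq s w
  exact (Term.realize_quotient_mk' s e.1 w).trans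
    ((congrArg _ (h w)).trans (Term.realize_quotient_mk' s e.2 w).symm)

variable {B : Type u} [BooleanAlgebra B] {I : Order.Ideal B} {f g : B → B} {x y x' y' : B}

/-- Congruence modulo an ideal of a Boolean algebra. -/
def idealSetoid (I : Order.Ideal B) : Setoid B where
  r x y := x ∆ y ∈ I
  iseqv :=
    { refl := fun x => by rw [symmDiff_self]; exact I.bot_mem
      symm := fun {x y} h => by rwa [symmDiff_comm]
      trans := fun h h' => I.lower (symmDiff_triangle _ _ _) (Order.Ideal.sup_mem h h') }

theorem idealSetoid_bot_iff : idealSetoid I x ⊥ ↔ x ∈ I := by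
  change x ∆ ⊥ ∈ I ↔ x ∈ I
  rw [symmDiff_bot]

theorem idealSetoid_top_iff : idealSetoid I x ⊤ ↔ xᶜ ∈ I := by
  change x ∆ ⊤ ∈ I ↔ xᶜ ∈ I
  rw [symmDiff_top, hnot_eq_compl]

theorem idealSetoid_compl (h : idealSetoid I x y) : idealSetoid I xᶜ yᶜ := by
  change xᶜ ∆ yᶜ ∈ I
  rwa [compl_symmDiff_compl]

theorem idealSetoid_sup (h : idealSetoid I x y) (h' : idealSetoid I x' y') :
    idealSetoid I (x ⊔ x') (y ⊔ y') := by
  refine I.lower (symmDiff_le_iff.2 ?_) (Order.Ideal.sup_mem h h')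
  rw [sup_sup_sup_comm, sup_sup_sup_comm x]
  obtain ⟨hxy, hyx⟩ := symmDiff_le_iff.1 (le_refl (x ∆ y))
  obtain ⟨hxy', hyx'⟩ := symmDiff_le_iff.1 (le_refl (x' ∆ y'))
  exact ⟨sup_le_sup hxy hxy', sup_le_sup hyx hyx'⟩

theorem idealSetoid_inf (h : idealSetoid I x y) (h' : idealSetoid I x' y') :
    idealSetoid I (x ⊓ x') (y ⊓ y') := by
  simpa only [compl_sup, compl_compl] using
    idealSetoid_compl (idealSetoid_sup (idealSetoid_compl h) (idealSetoid_compl h'))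

theorem IsModalOperator.idealSetoid_map (hf : IsModalOperator f) (hfI : ∀ x ∈ I, f x ∈ I)
    (h : idealSetoid I x y) : idealSetoid I (f x) (f y) :=
  I.lower (hf.symmDiff_map_le x y) (hfI _ h)

/-- The congruence of the bimodal algebra `⟨B, f, g⟩` given by an ideal closed under `f` and `g`,
as a prestructure, so that the quotient inherits the operations. -/
abbrev idealPrestructure (hf : IsModalOperator f) (hg : IsModalOperator g)
    (hfI : ∀ x ∈ I, f x ∈ I) (hgI : ∀ x ∈ I, g x ∈ I) :
    bimodalLang.Prestructure (idealSetoid I) where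
  toStructure := bimodalStructure f g
  fun_equiv {n} op x y h := by
    cases op with
    | zero => exact (idealSetoid I).refl _
    | one => exact (idealSetoid I).refl _
    | compl => exact idealSetoid_compl (h 0)
    | opF => exact hf.idealSetoid_map hfI (h 0)
    | opG => exact hg.idealSetoid_map hgI (h 0)
    | add => exact idealSetoid_sup (h 0) (h 1)
    | mul => exact idealSetoid_inf (h 0) (h 1)
  rel_equiv {n} r := r.elim

/-- The quotient of the bimodal algebra `⟨B, f, g⟩` by an ideal closed under `f` and `g`. -/
def idealQuotient (hf : IsModalOperator f) (hg : IsModalOperator g)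
    (hfI : ∀ x ∈ I, f x ∈ I) (hgI : ∀ x ∈ I, g x ∈ I) : Alg.{u} :=
  letI := idealPrestructure hf hg hfI hgI
  ⟨Quotient (idealSetoid I), quotientStructure⟩

variable (hf : IsModalOperator f) (hg : IsModalOperator g)
  (hfI : ∀ x ∈ I, f x ∈ I) (hgI : ∀ x ∈ I, g x ∈ I)

theorem realize_idealQuotient {α : Type*} (t : bimodalLang.Term α) (w : α → B) :
    t.realize (M := idealQuotient hf hg hfI hgI) (fun i => (⟦w i⟧ : Quotient (idealSetoid I))) =
      (⟦t.realize (M := bimodalAlg f g) w⟧ : Quotient (idealSetoid I)) :=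
  letI := idealPrestructure hf hg hfI hgI
  Term.realize_quotient_mk' (idealSetoid I) t w

theorem symmDiff_realize_mem_of_satisfies_idealQuotient {e : Equation}
    (h : Satisfies (idealQuotient hf hg hfI hgI) e) (w : ℕ → B) :
    e.1.realize (M := bimodalAlg f g) w ∆ e.2.realize (M := bimodalAlg f g) w ∈ I := by
  have realize_eq := h fun n => (⟦w n⟧ : Quotient (idealSetoid I))
  rw [realize_idealQuotient, realize_idealQuotient] at realize_eq
  exact Quotient.exact realize_eq

theorem idealQuotient_mem_DDA [I.IsProper] (hI : ∀ x ∉ I, (f x ⊔ g x)ᶜ ∈ I) :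
    idealQuotient hf hg hfI hgI ∈ DDA := by
  have : Nontrivial (idealQuotient hf hg hfI hgI) := by
    refine ⟨(⟦⊤⟧ : Quotient (idealSetoid I)), (⟦⊥⟧ : Quotient (idealSetoid I)), fun h => ?_⟩
    have top_mem : ⊤ ∈ I := idealSetoid_bot_iff.1 (Quotient.exact h)
    exact Order.Ideal.isProper_iff_top_notMem.1 ‹_› top_mem
  have bimodal : idealQuotient hf hg hfI hgI ∈ modelsOf (booleanEquations ∪ modalEquations) :=
    letI := idealPrestructure hf hg hfI hgI
    fun e he => Satisfies.quotient (idealSetoid I)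
      (mem_modelsOf_bimodalEquations_iff.2 ⟨B, _, f, g, rfl, hf, hg⟩ e he)
  refine mem_DDA_of_realize bimodal fun w hw => ?_
  obtain ⟨w, rfl⟩ := exists_quotientMk_comp_eq (idealSetoid I) w
  rw [realize_idealQuotient] at hw
  rw [realize_idealQuotient, realize_idealQuotient]
  have notMem : w 0 ∉ I := fun h => hw (Quotient.sound (idealSetoid_bot_iff.2 h))
  exact Quotient.sound (idealSetoid_top_iff.2 (hI _ notMem))

end Quotients

theorem KtDDA_subset_eqClass_DDA : KtDDA.{u} ⊆ eqClass DDA := by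
  intro A hA
  obtain ⟨B, _, f, g, rfl, hf, hg, hu⟩ := mem_KtDDA_iff.1 hA
  rw [eqClass_eq_modelsOf]
  intro e he w
  by_contra hne
  obtain ⟨I, h_notMem, h_closed, h_compl⟩ := exists_ideal_notMem_of_isS5Possibility (hf.sup hg)
    (isS5Necessity_meetDual_iff.1 hu) (mt symmDiff_eq_bot.1 hne)
  have hfI : ∀ x ∈ I, f x ∈ I := fun x hx => (Order.Ideal.sup_mem_iff.1 (h_closed x hx)).1
  have hgI : ∀ x ∈ I, g x ∈ I := fun x hx => (Order.Ideal.sup_mem_iff.1 (h_closed x hx)).2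
  have : I.IsProper := Order.Ideal.isProper_of_notMem h_notMem
  have valid : Satisfies (idealQuotient hf hg hfI hgI) e :=
    he _ (idealQuotient_mem_DDA hf hg hfI hgI h_compl)
  exact h_notMem (symmDiff_realize_mem_of_satisfies_idealQuotient hf hg hfI hgI valid w)

end ModalDecomp

theorem mainTheorem6 : ModalDecomp.eqClass.{u} ModalDecomp.DDA = ModalDecomp.KtDDA :=
  Set.Subset.antisymm
    (fun _ hA => hA _ ModalDecomp.isEquationalClass_KtDDA ModalDecomp.DDA_subset_KtDDA)
    ModalDecomp.KtDDA_subset_eqClass_DDA
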